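/- **Setting.** Equip $\mathbb{R}^q$ with the norm $\|\cdot\|=\|\cdot\|_1$, and let $B_1(0)$ be its closed unit ball and $d_H$ the induced Hausdorff distance. For $A\subseteq\mathbb{R}^q$ let $\operatorname{cone}A$ be the convex conic hull ($\operatorname{cone}\emptyset=\{0\}$), $A_\infty=\{d\mid y+\alpha d\in A\ \ \forall y\in A,\ \alpha\ge 0\}$ the recession cone, and for a cone $C$ let $C^+=\{z\mid z^{\mathsf T}y\ge 0\ \ \forall y\in C\}$. Consider the convex vector optimization problem $$\text{(P)}\qquad\text{minimize }\Gamma(x)\ \text{ with respect to }\le_C\ \text{ subject to }x\in\mathcal X ,$$ where $\mathcal X\subseteq\mathbb{R}^n$ is closed and convex with $\operatorname{int}\mathcal X\ne\emptyset$ (in particular (P) is feasible), $C\subseteq\mathbb{R}^q$ is a polyhedral (hence closed) convex cone with $\{0\}\subsetneq C\subsetneq\mathbb{R}^q$ that is pointed (contains no line through the origin) and has nonempty interior, $v\le_C w$ means $w-v\in C$, and $\Gamma:\mathcal X\to\mathbb{R}^q$ is continuous and $C$-convex, i.e. $\Gamma(\alpha x+(1-\alpha)y)\le_C\alpha\Gamma(x)+(1-\alpha)\Gamma(y)$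 for $x,y\in\mathcal X$, $\alpha\in[0,1]$. The upper image is $\mathcal P=\operatorname{cl}(\Gamma(\mathcal X)+C)$. A problem with ordering cone $K$ is *bounded* if $K$ is closed and its upper image $\operatorname{cl}(\Gamma(\mathcal X)+K)$ is contained in $\{p\}+K$ for some $p\in\mathbb{R}^q$. A finite set $\mathcal Y\subseteq\mathbb{R}^q$ is a *finite $\delta$-outer* (respectively *finite $\delta$-inner*) *approximation* of $\mathcal P_\infty$ if $\mathcal P_\infty\subseteq\operatorname{cone}\mathcal Y$ (respectively $\operatorname{cone}\mathcal Y\subseteq\mathcal P_\infty$) and $d_H(\mathcal P_\infty\cap B_1(0),\operatorname{cone}\mathcal Y\cap B_1(0))\le\delta$. **Scalarizations.** For $w\in\mathbb{R}^q$, (P$_1(w)$) is: minimize $w^{\mathsf T}\Gamma(x)$ subject to $x\in\mathcal X$. For $v\in\mathbb{R}^q$ and $d\in\mathbb{R}^q\setminus\{0\}$, (P$_2(v,d)$) is: maximize $z$ subject to $x\in\mathcal X$, $z\in\mathbb{R}$, $\Gamma(x)-v-zd\le_C 0$; and (D$_2(v,d)$) is: minimize $\sup_{x\in\mathcal X}\{-w^{\mathsf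 T}\Gamma(x)\}+w^{\mathsf T}v$ subject to $w\in C^+$, $w^{\mathsf T}d=-1$. **Algorithm 1.** Fix $c\in\operatorname{int}C$ with $\|c\|=1$. Input: (P); a finite set $R$ with $\operatorname{cone}R=C$ and $\|d\|=1$ for $d\in R$; a finite set $R^*$ with $\operatorname{cone}R^*=C^+$ and $c^{\mathsf T}z=1$ for $z\in R^*$; a tolerance $\delta>0$. 1. Set $\mathcal Y_{In}=R$, $\hat C=\emptyset$, $\mathcal P_0=\mathbb{R}^q$, $\bar{\mathcal X}=\emptyset$, $b=1$. 2. If $\mathcal X=\emptyset$, stop. Otherwise choose $x_0\in\mathcal X$ and set $v=\Gamma(x_0)+\sum_{d\in R}d$. 3. For each $z\in R^*$: if (P$_1(z)$) is unbounded, set $b=0$; if $x^*$ is an optimal solution of (P$_1(z)$), add $x^*$ to $\bar{\mathcal X}$ and replace $\mathcal P_0$ by $\mathcal P_0\cap\{y\mid z^{\mathsf T}(y-\Gamma(x^*))\ge 0\}$. 4. If $b=1$, set $\mathcal Y_{Out}=R$ and stop. 5. For each $d\in -R$: if (P$_2(v,d)$) is unbounded, add $d$ to $\mathcal Y_{In}$;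 if $(x,z)$ and $w$ are optimal solutions of (P$_2(v,d)$) and (D$_2(v,d)$), add $x$ to $\bar{\mathcal X}$ and replace $\mathcal P_0$ by $\mathcal P_0\cap\{y\mid w^{\mathsf T}(y-\Gamma(x))\ge 0\}$. 6. Set $\mathcal Y_{Out}=\operatorname{vert}((\mathcal P_0)_\infty\cap B_1(0))\setminus\{0\}$, where $\operatorname{vert}$ denotes the set of vertices (extreme points). 7. While $\mathcal Y_{Out}\setminus(\mathcal Y_{In}\cup\hat C)\ne\emptyset$, choose $d$ in this set and $\tilde r\in\mathcal Y_{In}$ minimizing $\|d-r\|$ over $r\in\mathcal Y_{In}$. (a) If $\|d-\tilde r\|\le\delta$, add $d$ to $\hat C$. (b) If $\|d-\tilde r\|>\delta$, choose $\lambda\in(0,1)$ such that $u:=\lambda d+(1-\lambda)\tilde r\neq 0$. If (P$_2(v,u)$) is unbounded, add $u/\|u\|$ to $\mathcal Y_{In}$. If $(x,z)$ and $w$ are optimal solutions of (P$_2(v,u)$) and (D$_2(v,u)$), add $x$ to $\bar{\mathcal X}$, replace $\mathcal P_0$ by $\mathcal P_0\cap\{y\mid w^{\mathsf T}(y-\Gamma(x))\ge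 0\}$ and recompute $\mathcal Y_{Out}=\operatorname{vert}((\mathcal P_0)_\infty\cap B_1(0))\setminus\{0\}$. When the loop ends, stop; the output contains $\mathcal Y_{In}$ and $\mathcal Y_{Out}$. All choices are arbitrary; termination presupposes that each scalar problem that is met and is bounded has an optimal solution. **Theorem.** Suppose that a run of Algorithm 1 (with any admissible choices) on such a problem (P) terminates after finitely many steps. Then $\mathcal Y_{Out}$ is a finite $\delta$-outer approximation of $\mathcal P_\infty$, $\mathcal Y_{In}$ is a finite $\delta$-inner approximation of $\mathcal P_\infty$, and the problem $$\text{(P')}\qquad\text{minimize }\Gamma(x)\ \text{ with respect to }\le_{\operatorname{cone}\mathcal Y_{Out}}\ \text{ subject to }x\in\mathcal X$$ is bounded. -/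

import Mathlib

open scoped Pointwise

noncomputable section

namespace CVOPAlg

/-- The decision space `ℝⁿ`. -/
abbrev Decision (n : ℕ) : Type := EuclideanSpace ℝ (Fin n)

/-- The outcome space `ℝ^q`, with the `ℓ₁` norm `‖y‖ = ∑ i, |y i|` and its metric. -/
abbrev Outcome (q : ℕ) : Type := PiLp 1 (fun _ : Fin q => ℝ)

variable {n q : ℕ}

/-- The scalar product `wᵀ y`. -/
def tdot (w y : Outcome q) : ℝ := ∑ i, w i * y i

/-- The convex conic hull of a set of directions; `cone ∅ = {0}`. -/
abbrev coneHull (Y : Set (Outcome q)) : PointedCone ℝ (Outcome q) := PointedCone.hull ℝ Y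

/-- The positive dual cone. -/
def dualCone (C : Set (Outcome q)) : Set (Outcome q) := {z | ∀ y ∈ C, 0 ≤ tdot z y}

/-- The recession cone of a set. -/
def recessionCone (A : Set (Outcome q)) : Set (Outcome q) :=
  {d | ∀ y ∈ A, ∀ α : ℝ, 0 ≤ α → y + α • d ∈ A}

/-- The closed `ℓ₁` unit ball around the origin. -/
def unitBall (q : ℕ) : Set (Outcome q) := Metric.closedBall 0 1

/-- A polyhedral convex set: a finite intersection of closed halfspaces. -/
def IsPolyhedral (A : Set (Outcome q)) : Prop :=
  ∃ H : Finset (Outcome q × ℝ), (∀ h ∈ H, h.1 ≠ 0) ∧ A = {y | ∀ h ∈ H, h.2 ≤ tdot h.1 y}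

/-- The data of a vector optimization problem
`minimize Γ(x) with respect to ≤_C subject to x ∈ X`. -/
structure VOP (n q : ℕ) where
  /-- the feasible set -/
  X : Set (Decision n)
  /-- the objective function; only its values on `X` matter -/
  Γ : Decision n → Outcome q
  /-- the (convex) ordering cone -/
  C : PointedCone ℝ (Outcome q)

namespace VOP

variable (P : VOP n q)

/-- `v ≤_C w`. -/
def le (v w : Outcome q) : Prop := w - v ∈ P.C

/-- `Γ` is `C`-convex on `X`. -/
def CConvex : Prop :=
  ∀ x ∈ P.X, ∀ y ∈ P.X, ∀ α : ℝ, 0 ≤ α → α ≤ 1 →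
    P.le (P.Γ (α • x + (1 - α) • y)) (α • P.Γ x + (1 - α) • P.Γ y)

/-- The standing assumptions on a convex vector optimization problem. -/
structure IsCVOP : Prop where
  closed_X : IsClosed P.X
  convex_X : Convex ℝ P.X
  interior_X : (interior P.X).Nonempty
  closed_C : IsClosed (P.C : Set (Outcome q))
  /-- the cone is non-trivial: `{0} ⊊ C ⊊ ℝ^q` -/
  ne_bot_C : P.C ≠ ⊥
  ne_top_C : P.C ≠ ⊤
  /-- the cone is pointed: it contains no line through the origin -/
  pointed_C : ∀ y, y ∈ P.C → -y ∈ P.C → y = 0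
  /-- the cone is solid -/
  solid_C : (interior (P.C : Set (Outcome q))).Nonempty
  continuous_Γ : ContinuousOn P.Γ P.X
  cconvex_Γ : P.CConvex

/-- The standing assumptions together with polyhedrality of the ordering cone. -/
structure IsPolyhedralCVOP : Prop extends P.IsCVOP where
  polyhedral_C : IsPolyhedral (P.C : Set (Outcome q))

/-- The problem is feasible. -/
def Feasible : Prop := P.X.Nonempty

/-- The upper image `cl (Γ(X) + C)`. -/
def upperImage : Set (Outcome q) := closure (P.Γ '' P.X + (P.C : Set (Outcome q)))

/-- The problem is bounded with respect to a closed convex cone `K ⊇ C`. -/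
def BoundedWrt (K : PointedCone ℝ (Outcome q)) : Prop :=
  P.C ≤ K ∧ IsClosed (K : Set (Outcome q)) ∧
    ∃ p : Outcome q, P.upperImage ⊆ {p} + (K : Set (Outcome q))

/-- The problem is bounded: bounded with respect to its own ordering cone. -/
def Bounded : Prop := P.BoundedWrt P.C

/-- The same problem with another ordering cone. -/
def withCone (K : PointedCone ℝ (Outcome q)) : VOP n q := { P with C := K }

/-! ### Scalarizations -/

/-- The weighted sum scalarization `min wᵀ Γ(x), x ∈ X`, is unbounded. -/
def P1Unbounded (w : Outcome q) : Prop := ¬ BddBelow ((fun x => tdot w (P.Γ x)) '' P.X)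

/-- `x` is an optimal solution of the weighted sum scalarization. -/
def P1Optimal (w : Outcome q) (x : Decision n) : Prop :=
  x ∈ P.X ∧ ∀ x' ∈ P.X, tdot w (P.Γ x) ≤ tdot w (P.Γ x')

/-- `(x, z)` is feasible for the Pascoletti–Serafini scalarization
`max z` subject to `x ∈ X`, `Γ(x) - v - z d ≤_C 0`. -/
def P2Feasible (v d : Outcome q) (x : Decision n) (z : ℝ) : Prop :=
  x ∈ P.X ∧ P.le (P.Γ x - v - z • d) 0

/-- The Pascoletti–Serafini scalarization is unbounded. -/
def P2Unbounded (v d : Outcome q) : Prop := ¬ BddAbove {z : ℝ | ∃ x, P.P2Feasible v d x z}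

/-- `(x, z)` is an optimal solution of the Pascoletti–Serafini scalarization. -/
def P2Optimal (v d : Outcome q) (x : Decision n) (z : ℝ) : Prop :=
  P.P2Feasible v d x z ∧ ∀ x' z', P.P2Feasible v d x' z' → z' ≤ z

/-- `w` is feasible for the Lagrangian dual of the Pascoletti–Serafini scalarization. -/
def D2Feasible (d w : Outcome q) : Prop :=
  w ∈ dualCone (P.C : Set (Outcome q)) ∧ tdot w d = -1

/-- The objective `sup_{x ∈ X} {-wᵀ Γ(x)} + wᵀ v` of the Lagrangian dual, with extended real
values. -/
def D2Objective (v w : Outcome q) : EReal :=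
  (⨆ x ∈ P.X, ((-tdot w (P.Γ x) : ℝ) : EReal)) + ((tdot w v : ℝ) : EReal)

/-- `w` is an optimal solution of the Lagrangian dual. -/
def D2Optimal (v d w : Outcome q) : Prop :=
  P.D2Feasible d w ∧ ∀ w', P.D2Feasible d w' → P.D2Objective v w ≤ P.D2Objective v w'

/-! ### Approximations of the recession cone of the upper image -/

/-- The Hausdorff distance of `P_∞ ∩ B₁(0)` and `cone Y ∩ B₁(0)` is at most `δ`. -/
def WithinDelta (δ : ℝ) (Y : Set (Outcome q)) : Prop :=
  Metric.hausdorffEDist (recessionCone P.upperImage ∩ unitBall q)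
    ((coneHull Y : Set (Outcome q)) ∩ unitBall q) ≤ ENNReal.ofReal δ

/-- `Y` is a finite `δ`-outer approximation of `P_∞`. -/
def IsFiniteOuterApprox (δ : ℝ) (Y : Set (Outcome q)) : Prop :=
  Y.Finite ∧ recessionCone P.upperImage ⊆ (coneHull Y : Set (Outcome q)) ∧ P.WithinDelta δ Y

/-- `Y` is a finite `δ`-inner approximation of `P_∞`. -/
def IsFiniteInnerApprox (δ : ℝ) (Y : Set (Outcome q)) : Prop :=
  Y.Finite ∧ (coneHull Y : Set (Outcome q)) ⊆ recessionCone P.upperImage ∧ P.WithinDelta δ Y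

end VOP

/-! ### The algorithm -/

/-- `R` is a set of generating directions of `C`, normalized to `‖d‖ = 1`. -/
def IsGenerators (C : PointedCone ℝ (Outcome q)) (R : Finset (Outcome q)) : Prop :=
  coneHull (R : Set (Outcome q)) = C ∧ ∀ d ∈ R, ‖d‖ = 1

/-- `R'` is a set of generating directions of the dual cone `C⁺`, normalized to `cᵀ z = 1`. -/
def IsDualGenerators (C : PointedCone ℝ (Outcome q)) (c : Outcome q)
    (R' : Finset (Outcome q)) : Prop :=
  (coneHull (R' : Set (Outcome q)) : Set (Outcome q)) = dualCone (C : Set (Outcome q)) ∧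
    ∀ z ∈ R', tdot c z = 1

/-- The halfspace `{y | wᵀ (y - y₀) ≥ 0}`. -/
def halfspace (w y₀ : Outcome q) : Set (Outcome q) := {y | 0 ≤ tdot w (y - y₀)}

/-- The set `vert (A_∞ ∩ B₁(0)) \ {0}`. -/
def outerDirections (A : Set (Outcome q)) : Set (Outcome q) :=
  Set.extremePoints ℝ (recessionCone A ∩ unitBall q) \ {0}

/-- The program counter. The two `for all` loops of the initialization carry the set of elements
that are still to be treated. -/
inductive Phase (q : ℕ) : Type
  /-- Step 2 is next -/
  | feasibility
  /-- inside the loop of Step 3 -/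
  | boundedness (todo : Set (Outcome q))
  /-- Step 4 is next -/
  | decide
  /-- inside the loop of Step 5 -/
  | lineality (todo : Set (Outcome q))
  /-- Step 6 is next -/
  | outer
  /-- at the head of the while loop of Step 7 -/
  | iteration
  /-- the algorithm has stopped -/
  | stopped

/-- The values of the variables of the algorithm. -/
structure State (n q : ℕ) where
  phase : Phase q
  YIn : Set (Outcome q)
  YOut : Set (Outcome q)
  /-- the set `Ĉ` of outer directions known to be within `δ` of an inner direction -/
  Chat : Set (Outcome q)
  /-- the current outer approximation of the upper image -/
  P0 : Set (Outcome q)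
  /-- the weak minimizers found so far -/
  Xbar : Set (Decision n)
  /-- the flag "no unbounded weighted sum scalarization found" -/
  b : Bool
  /-- the reference point -/
  v : Outcome q

/-- Step 1. The variables `YOut` and `v` get their values later; the entries here are never
read. -/
def initState (n : ℕ) (R : Finset (Outcome q)) : State n q where
  phase := .feasibility
  YIn := R
  YOut := ∅
  Chat := ∅
  P0 := Set.univ
  Xbar := ∅
  b := true
  v := 0

/-- One step of the algorithm. All choices (order in the loops, optimal solutions, directions `d`,
nearest inner directions `r`, weights `lam`) are left open. A scalar problem that is bounded but
has no optimal solution offers no step, so that the algorithm does not terminate properly. -/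
inductive Step (P : VOP n q) (R R' : Finset (Outcome q)) (δ : ℝ) :
    State n q → State n q → Prop
  /-- Step 2(a) -/
  | infeasible (s : State n q) : s.phase = .feasibility → ¬ P.Feasible →
      Step P R R' δ s { s with phase := .stopped }
  /-- Step 2(b) -/
  | feasible (s : State n q) (x₀ : Decision n) : s.phase = .feasibility → x₀ ∈ P.X →
      Step P R R' δ s
        { s with phase := .boundedness (R' : Set (Outcome q)), v := P.Γ x₀ + ∑ d ∈ R, d }
  /-- Step 3(a) -/
  | p1Unbounded (s : State n q) (todo : Set (Outcome q)) (z : Outcome q) :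
      s.phase = .boundedness todo → z ∈ todo → P.P1Unbounded z →
      Step P R R' δ s { s with phase := .boundedness (todo \ {z}), b := false }
  /-- Step 3(b) -/
  | p1Optimal (s : State n q) (todo : Set (Outcome q)) (z : Outcome q) (x : Decision n) :
      s.phase = .boundedness todo → z ∈ todo → P.P1Optimal z x →
      Step P R R' δ s
        { s with
          phase := .boundedness (todo \ {z})
          Xbar := s.Xbar ∪ {x}
          P0 := s.P0 ∩ halfspace z (P.Γ x) }
  /-- end of the loop of Step 3 -/
  | boundednessDone (s : State n q) : s.phase = .boundedness ∅ →
      Step P R R' δ s { s with phase := .decide }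
  /-- Step 4, the problem is bounded -/
  | stopBounded (s : State n q) : s.phase = .decide → s.b = true →
      Step P R R' δ s { s with phase := .stopped, YOut := (R : Set (Outcome q)) }
  /-- Step 4, the problem is not bounded -/
  | continueUnbounded (s : State n q) : s.phase = .decide → s.b = false →
      Step P R R' δ s { s with phase := .lineality (-(R : Set (Outcome q))) }
  /-- Step 5(a) -/
  | linealityUnbounded (s : State n q) (todo : Set (Outcome q)) (d : Outcome q) :
      s.phase = .lineality todo → d ∈ todo → P.P2Unbounded s.v d →
      Step P R R' δ s { s with phase := .lineality (todo \ {d}), YIn := s.YIn ∪ {d} }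
  /-- Step 5(b) -/
  | linealityOptimal (s : State n q) (todo : Set (Outcome q)) (d : Outcome q)
      (x : Decision n) (z : ℝ) (w : Outcome q) :
      s.phase = .lineality todo → d ∈ todo → P.P2Optimal s.v d x z → P.D2Optimal s.v d w →
      Step P R R' δ s
        { s with
          phase := .lineality (todo \ {d})
          Xbar := s.Xbar ∪ {x}
          P0 := s.P0 ∩ halfspace w (P.Γ x) }
  /-- end of the loop of Step 5 -/
  | linealityDone (s : State n q) : s.phase = .lineality ∅ →
      Step P R R' δ s { s with phase := .outer }
  /-- Step 6 -/
  | computeOuter (s : State n q) : s.phase = .outer →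
      Step P R R' δ s { s with phase := .iteration, YOut := outerDirections s.P0 }
  /-- Step 7(a) -/
  | close (s : State n q) (d r : Outcome q) : s.phase = .iteration →
      d ∈ s.YOut \ (s.YIn ∪ s.Chat) → r ∈ s.YIn → (∀ r' ∈ s.YIn, ‖d - r‖ ≤ ‖d - r'‖) →
      ‖d - r‖ ≤ δ →
      Step P R R' δ s { s with Chat := s.Chat ∪ {d} }
  /-- Step 7(b)i -/
  | farUnbounded (s : State n q) (d r : Outcome q) (lam : ℝ) : s.phase = .iteration →
      d ∈ s.YOut \ (s.YIn ∪ s.Chat) → r ∈ s.YIn → (∀ r' ∈ s.YIn, ‖d - r‖ ≤ ‖d - r'‖) →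
      δ < ‖d - r‖ → 0 < lam → lam < 1 → lam • d + (1 - lam) • r ≠ 0 →
      P.P2Unbounded s.v (lam • d + (1 - lam) • r) →
      Step P R R' δ s
        { s with
          YIn := s.YIn ∪
            {‖lam • d + (1 - lam) • r‖⁻¹ • (lam • d + (1 - lam) • r)} }
  /-- Step 7(b)ii -/
  | farOptimal (s : State n q) (d r : Outcome q) (lam : ℝ)
      (x : Decision n) (z : ℝ) (w : Outcome q) : s.phase = .iteration →
      d ∈ s.YOut \ (s.YIn ∪ s.Chat) → r ∈ s.YIn → (∀ r' ∈ s.YIn, ‖d - r‖ ≤ ‖d - r'‖) →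
      δ < ‖d - r‖ → 0 < lam → lam < 1 → lam • d + (1 - lam) • r ≠ 0 →
      P.P2Optimal s.v (lam • d + (1 - lam) • r) x z →
      P.D2Optimal s.v (lam • d + (1 - lam) • r) w →
      Step P R R' δ s
        { s with
          Xbar := s.Xbar ∪ {x}
          P0 := s.P0 ∩ halfspace w (P.Γ x)
          YOut := outerDirections (s.P0 ∩ halfspace w (P.Γ x)) }
  /-- end of the while loop of Step 7 -/
  | iterationDone (s : State n q) : s.phase = .iteration →
      s.YOut \ (s.YIn ∪ s.Chat) = ∅ →
      Step P R R' δ s { s with phase := .stopped }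

/-- Some run of the algorithm stops after finitely many steps, with `s` as the final values of its
variables. -/
def TerminatesWith (P : VOP n q) (R R' : Finset (Outcome q)) (δ : ℝ) (s : State n q) : Prop :=
  Relation.ReflTransGen (Step P R R' δ) (initState n R) s ∧ s.phase = .stopped

end CVOPAlg

end

/-! The proof is an invariant argument. Along every run, `YIn` consists of unit vectors in `P_∞`,
and `P0` is a polyhedron that contains the upper image and has finitely many normals, all positive
at `c`. For `YIn`: if (P₂(v,d)) is unbounded, then `v + z d` lies in the closed convex upper image
for arbitrarily large `z`, so `d` is a recession direction (`mem_recessionCone_of_unbounded`). For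
`P0`: the choice of `v` gives a Slater point, so strong duality holds, and a dual optimal `w` is
minimized over `Γ(X)` at the primal solution (`tdot_le_of_optimal`); the new halfspace therefore
supports the upper image. Hence `cone YIn ⊆ P_∞ ⊆ (P0)_∞`. When the loop ends, each nonzero vertex
of the truncated cone `(P0)_∞ ∩ B₁(0)` is `δ`-close to `YIn`. Closed thickenings of convex sets are
convex, so the whole truncated cone is `δ`-close to `cone YIn`, and the sandwich yields both
Hausdorff bounds. These vertices generate `(P0)_∞`, hence `cone YOut = (P0)_∞`. Positivity of the
normals at `c` puts `P0` into a translate of this cone, which is boundedness of (P'). If the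
algorithm stops early, the weights generating `C⁺` are all bounded below on `P0`, and the bipolar
theorem gives `(P0)_∞ = C`. -/

open scoped Pointwise

noncomputable section

namespace CVOPAlg

variable {n q : ℕ}

/-! ### The scalar product -/

/-- The functional `y ↦ wᵀ y`. -/
def tdotLin (w : Outcome q) : Outcome q →ₗ[ℝ] ℝ where
  toFun := tdot w
  map_add' x y := by simp [tdot, mul_add, Finset.sum_add_distrib]
  map_smul' a x := by simp [tdot, Finset.mul_sum, mul_left_comm]

theorem tdot_add (w x y : Outcome q) : tdot w (x + y) = tdot w x + tdot w y :=
  map_add (tdotLin w) x y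

theorem tdot_sub (w x y : Outcome q) : tdot w (x - y) = tdot w x - tdot w y :=
  map_sub (tdotLin w) x y

theorem tdot_smul (w : Outcome q) (a : ℝ) (x : Outcome q) : tdot w (a • x) = a * tdot w x :=
  map_smul (tdotLin w) a x

theorem tdot_zero (w : Outcome q) : tdot w 0 = 0 := map_zero (tdotLin w)

theorem continuous_tdot (w : Outcome q) : Continuous (tdot w) :=
  (tdotLin w).continuous_of_finiteDimensional

theorem tdot_comm (w y : Outcome q) : tdot w y = tdot y w := by
  simp [tdot, mul_comm]

theorem exists_tdot_eq (f : Outcome q →ₗ[ℝ] ℝ) : ∃ w : Outcome q, ∀ y, f y = tdot w y := by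
  refine ⟨WithLp.toLp 1 fun i => f (PiLp.basisFun 1 ℝ (Fin q) i), fun y => ?_⟩
  conv_lhs => rw [← (PiLp.basisFun 1 ℝ (Fin q)).sum_repr y]
  simp [tdot, mul_comm]

/-! ### Cones -/

theorem coneHull_le {Y : Set (Outcome q)} {K : PointedCone ℝ (Outcome q)}
    (h : Y ⊆ (K : Set (Outcome q))) : coneHull Y ≤ K :=
  Submodule.span_le.2 h

theorem subset_coneHull (Y : Set (Outcome q)) : Y ⊆ (coneHull Y : Set (Outcome q)) :=
  Submodule.subset_span

theorem add_mem_interior {K : PointedCone ℝ (Outcome q)} {x y : Outcome q}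
    (hx : x ∈ interior (K : Set (Outcome q))) (hy : y ∈ K) :
    x + y ∈ interior (K : Set (Outcome q)) := by
  have h : interior (K : Set (Outcome q)) + {y} ⊆ interior (K : Set (Outcome q)) := by
    refine interior_maximal ?_ isOpen_interior.add_right
    rintro _ ⟨a, ha, b, rfl, rfl⟩
    exact K.add_mem (interior_subset ha) hy
  exact h ⟨x, hx, y, rfl, rfl⟩

theorem smul_mem_interior {K : PointedCone ℝ (Outcome q)} {x : Outcome q}
    (hx : x ∈ interior (K : Set (Outcome q))) {a : ℝ} (ha : 0 < a) :
    a • x ∈ interior (K : Set (Outcome q)) := by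
  have h : a • interior (K : Set (Outcome q)) ⊆ interior (K : Set (Outcome q)) := by
    refine interior_maximal ?_ (isOpen_interior.smul₀ ha.ne')
    rintro _ ⟨b, hb, rfl⟩
    exact K.smul_mem ha.le (interior_subset hb)
  exact h ⟨x, hx, rfl⟩

/-- The sum of a finite set of generators of a solid cone is an interior point. -/
theorem sum_generators_mem_interior {K : PointedCone ℝ (Outcome q)} {R : Finset (Outcome q)}
    (hR : coneHull (R : Set (Outcome q)) = K) {c : Outcome q}
    (hc : c ∈ interior (K : Set (Outcome q))) :
    ∑ d ∈ R, d ∈ interior (K : Set (Outcome q)) := by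
  have hcK : c ∈ coneHull (R : Set (Outcome q)) := hR ▸ interior_subset hc
  obtain ⟨f, -, hf⟩ := Submodule.mem_span_finset.1 hcK
  -- `M` is positive and dominates every coefficient of `c`, so `M • ∑ d` is `c` plus an element of
  -- the cone.
  set M : ℝ := 1 + ∑ d ∈ R, (f d : ℝ) with hM
  have hM0 : 0 < M := by
    have : 0 ≤ ∑ d ∈ R, (f d : ℝ) := Finset.sum_nonneg fun d _ => (f d).2
    linarith
  have hle : ∀ d ∈ R, (f d : ℝ) ≤ M := fun d hd => by
    have := Finset.single_le_sum (f := fun d => (f d : ℝ)) (fun d _ => (f d).2) hd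
    linarith
  have hrest : ∑ d ∈ R, (M - f d) • d ∈ K := by
    refine K.sum_mem fun d hd => K.smul_mem (sub_nonneg.2 (hle d hd)) ?_
    exact hR ▸ subset_coneHull _ hd
  have heq : M • ∑ d ∈ R, d = c + ∑ d ∈ R, (M - f d) • d := by
    have : c = ∑ d ∈ R, (f d : ℝ) • d := hf.symm
    rw [this, ← Finset.sum_add_distrib, Finset.smul_sum]
    exact Finset.sum_congr rfl fun d _ => by rw [← add_smul]; congr 1; ring
  have h := smul_mem_interior (heq ▸ add_mem_interior hc hrest) (inv_pos.2 hM0)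
  rwa [smul_smul, inv_mul_cancel₀ hM0.ne', one_smul] at h

/-- A nonzero functional that is nonnegative on a cone is positive on its interior. -/
theorem tdot_pos_of_mem_interior {K : PointedCone ℝ (Outcome q)} {c w d : Outcome q}
    (hc : c ∈ interior (K : Set (Outcome q))) (hw : w ∈ dualCone (K : Set (Outcome q)))
    (hd : tdot w d ≠ 0) : 0 < tdot w c := by
  -- A small move from `c` towards such an `e` stays in `K`, where `w` is nonnegative; this forces
  -- `w` to be positive at `c`.
  have key : ∃ e : Outcome q, tdot w e < 0 := by
    rcases hd.lt_or_gt with h | h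
    · exact ⟨d, h⟩
    · refine ⟨(-1 : ℝ) • d, ?_⟩
      rw [tdot_smul]; linarith
  obtain ⟨e, he⟩ := key
  have hcont : Filter.Tendsto (fun t : ℝ => c + t • e) (nhdsWithin 0 (Set.Ioi 0)) (nhds c) := by
    have : Continuous fun t : ℝ => c + t • e := by fun_prop
    simpa using (this.tendsto 0).mono_left nhdsWithin_le_nhds
  obtain ⟨t, ht, htpos⟩ := ((hcont.eventually (mem_interior_iff_mem_nhds.1 hc)).and
    self_mem_nhdsWithin).exists
  have h0 := hw _ ht
  rw [tdot_add, tdot_smul] at h0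
  have : t * tdot w e < 0 := mul_neg_of_pos_of_neg htpos he
  linarith

/-- The bipolar theorem for a closed convex cone. -/
theorem mem_of_forall_dualCone {K : PointedCone ℝ (Outcome q)}
    (hK : IsClosed (K : Set (Outcome q))) {y : Outcome q}
    (hy : ∀ w ∈ dualCone (K : Set (Outcome q)), 0 ≤ tdot w y) : y ∈ K := by
  by_contra hyK
  obtain ⟨f, hf, hfy⟩ := ProperCone.hyperplane_separation_point
    (⟨K, hK⟩ : ProperCone ℝ (Outcome q)) hyK
  obtain ⟨w, hw⟩ := exists_tdot_eq f.toLinearMap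
  have h := hy w fun x hx => (hw x) ▸ hf x hx
  rw [← hw y] at h
  exact absurd hfy (not_lt.2 h)

theorem tdot_nonneg_of_mem_coneHull {Y : Set (Outcome q)} {d w : Outcome q}
    (h : ∀ z ∈ Y, 0 ≤ tdot z d) (hw : w ∈ coneHull Y) : 0 ≤ tdot w d := by
  induction hw using Submodule.span_induction with
  | mem x hx => exact h x hx
  | zero => rw [tdot_comm, tdot_zero]
  | add x y _ _ hx hy => rw [tdot_comm, tdot_add, tdot_comm d, tdot_comm d]; exact add_nonneg hx hy
  | smul a x _ hx =>
    change 0 ≤ tdot ((a : ℝ) • x) d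
    rw [tdot_comm, tdot_smul, tdot_comm]
    exact mul_nonneg a.2 hx

/-! ### Recession cones -/

/-- The recession cone of a set as a convex cone. -/
def recessionPointedCone (A : Set (Outcome q)) : PointedCone ℝ (Outcome q) where
  carrier := recessionCone A
  zero_mem' := fun y hy α _ => by simpa using hy
  add_mem' := fun {d e} hd he y hy α hα => by
    rw [smul_add, ← add_assoc]
    exact he _ (hd y hy α hα) α hα
  smul_mem' := fun a d hd y hy α hα => by
    have := hd y hy (α * a) (mul_nonneg hα a.2)
    rwa [mul_smul] at this

/-- A direction of which one point of a closed convex set admits arbitrarily large multiples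
belongs to the recession cone. -/
theorem mem_recessionCone_of_unbounded {A : Set (Outcome q)} (hA : Convex ℝ A)
    (hcl : IsClosed A) {v d : Outcome q} (h : ¬ BddAbove {z : ℝ | v + z • d ∈ A}) :
    d ∈ recessionCone A := by
  intro y hy α hα
  have hfreq : ∃ᶠ t in (Filter.atTop : Filter ℝ), v + t • d ∈ A := by
    refine Filter.frequently_atTop.2 fun a => ?_
    obtain ⟨b, hb, hab⟩ := not_bddAbove_iff.1 h a
    exact ⟨b, hab.le, hb⟩
  -- This is the convex combination of `y` and `v + t • d` with weight `α / t` on the latter. It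
  -- lies in `A` whenever `v + t • d` does and `t ≥ α`, `t > 0`.
  have hlim : Filter.Tendsto (fun t : ℝ => y + (α * t⁻¹) • (v - y) + α • d) Filter.atTop
      (nhds (y + α • d)) := by
    have h0 : Filter.Tendsto (fun t : ℝ => α * t⁻¹) Filter.atTop (nhds 0) := by
      simpa using tendsto_inv_atTop_zero.const_mul α
    simpa using ((h0.smul_const (v - y)).const_add y).add_const (α • d)
  refine hcl.mem_of_frequently_of_tendsto ?_ hlim
  refine (hfreq.and_eventually ((Filter.eventually_gt_atTop (0 : ℝ)).and
    (Filter.eventually_ge_atTop α))).mono ?_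
  rintro t ⟨ht, ht0, htα⟩
  have hle : α * t⁻¹ ≤ 1 := by rw [← div_eq_mul_inv]; exact (div_le_one ht0).2 htα
  have := hA hy ht (sub_nonneg.2 hle) (by positivity : 0 ≤ α * t⁻¹) (by ring)
  convert this using 1
  have : α • d = (α * t⁻¹) • t • d := by rw [smul_smul, mul_assoc, inv_mul_cancel₀ ht0.ne', mul_one]
  rw [this]; module

/-- A functional bounded below on a nonempty set is nonnegative on its recession cone. -/
theorem tdot_nonneg_of_mem_recessionCone {A : Set (Outcome q)} (hA : A.Nonempty) {w : Outcome q}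
    {γ : ℝ} (h : ∀ y ∈ A, γ ≤ tdot w y) {d : Outcome q} (hd : d ∈ recessionCone A) :
    0 ≤ tdot w d := by
  obtain ⟨y, hy⟩ := hA
  by_contra hneg
  push Not at hneg
  have h1 := h y hy
  -- The multiplier is chosen so that `w` takes the value `γ - 1` at the new point.
  have h2 := h _ (hd y hy ((tdot w y - γ + 1) / (-tdot w d))
    (div_nonneg (by linarith) (by linarith)))
  rw [tdot_add, tdot_smul, div_mul_eq_mul_div, div_neg, mul_div_assoc, div_self hneg.ne] at h2
  linarith

/-! ### Polyhedra and their recession cones -/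

/-- The polyhedron of a family of linear inequalities. -/
def polyhedron (H : Set (Outcome q × ℝ)) : Set (Outcome q) := {y | ∀ h ∈ H, h.2 ≤ tdot h.1 y}

theorem isClosed_polyhedron (H : Set (Outcome q × ℝ)) : IsClosed (polyhedron H) := by
  have : polyhedron H = ⋂ h ∈ H, {y | h.2 ≤ tdot h.1 y} := by ext; simp [polyhedron]
  rw [this]
  exact isClosed_biInter fun h _ => isClosed_le continuous_const (continuous_tdot h.1)

theorem polyhedron_union (H H' : Set (Outcome q × ℝ)) :
    polyhedron (H ∪ H') = polyhedron H ∩ polyhedron H' := by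
  ext y
  exact ⟨fun h => ⟨fun a ha => h a (Or.inl ha), fun a ha => h a (Or.inr ha)⟩,
    fun h a ha => ha.elim (h.1 a) (h.2 a)⟩

theorem halfspace_eq_polyhedron (w y : Outcome q) :
    halfspace w y = polyhedron {(w, tdot w y)} := by
  ext a
  simp [halfspace, polyhedron, tdot_sub]

theorem recessionCone_polyhedron {H : Set (Outcome q × ℝ)} (hne : (polyhedron H).Nonempty) :
    recessionCone (polyhedron H) = polyhedron ((fun h => (h.1, (0 : ℝ))) '' H) := by
  ext d
  constructor
  · rintro hd _ ⟨h, hh, rfl⟩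
    exact tdot_nonneg_of_mem_recessionCone hne (fun y hy => hy h hh) hd
  · intro hd y hy α hα h hh
    have h1 : 0 ≤ tdot h.1 d := hd _ ⟨h, hh, rfl⟩
    rw [tdot_add, tdot_smul]
    have := hy h hh
    have := mul_nonneg hα h1
    linarith

/-! ### Vertices of polytopes -/

/-- The `ℓ₁` norm is the maximum of the `2^q` signed sums of coordinates. This makes truncated
recession cones of polyhedra polyhedral again. -/
theorem unitBall_eq_polyhedron : unitBall q =
    polyhedron (Set.range fun ε : Fin q → Bool =>
      ((WithLp.toLp 1 fun i => if ε i then (1 : ℝ) else -1 : Outcome q), (-1 : ℝ))) := by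
  ext y
  simp only [unitBall, mem_closedBall_zero_iff, PiLp.norm_eq_of_L1, polyhedron,
    Set.forall_mem_range, Set.mem_ofPred_eq, tdot]
  constructor
  · intro h ε
    have : ∑ i, -‖y i‖ ≤ ∑ i, (if ε i then (1 : ℝ) else -1) * y i := by
      refine Finset.sum_le_sum fun i _ => ?_
      rw [Real.norm_eq_abs]
      split_ifs
      · linarith [neg_abs_le (y i)]
      · linarith [le_abs_self (y i)]
    rw [Finset.sum_neg_distrib] at this
    linarith
  · intro h
    -- The sign pattern opposite to `y` gives the tightest inequality.
    have h1 := h fun i => decide (y i ≤ 0)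
    have : ∑ i, (if decide (y i ≤ 0) then (1 : ℝ) else -1) * y i = ∑ i, -‖y i‖ := by
      refine Finset.sum_congr rfl fun i _ => ?_
      rw [Real.norm_eq_abs]
      by_cases hi : y i ≤ 0
      · simp [hi, abs_of_nonpos hi]
      · simp [hi, abs_of_pos (not_le.1 hi)]
    rw [this, Finset.sum_neg_distrib] at h1
    linarith

/-- A polyhedron given by finitely many inequalities has finitely many vertices. -/
theorem finite_extremePoints_polyhedron {H : Set (Outcome q × ℝ)} (hH : H.Finite) :
    (Set.extremePoints ℝ (polyhedron H)).Finite := by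
  -- A vertex is determined by its active constraints: if `y` satisfies those of `x` with equality,
  -- `x` can be moved slightly both ways along `y - x`.
  refine Set.Finite.of_finite_image (f := fun x => {h ∈ H | tdot h.1 x = h.2})
    (hH.finite_subsets.subset ?_) ?_
  · rintro _ ⟨x, -, rfl⟩
    exact fun h hh => hh.1
  intro x hx y hy hxy
  by_contra hne
  have hact : ∀ h ∈ H, tdot h.1 x = h.2 → tdot h.1 y = h.2 := fun h hh he =>
    ((Set.ext_iff.1 hxy h).1 ⟨hh, he⟩).2
  have hmem : ∀ᶠ t : ℝ in nhds 0, x + t • (y - x) ∈ polyhedron H := by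
    refine (Filter.eventually_all_finite hH).2 fun h hh => ?_
    by_cases he : tdot h.1 x = h.2
    · refine Filter.Eventually.of_forall fun t => ?_
      rw [tdot_add, tdot_smul, tdot_sub, hact h hh he, he]
      simp
    · have hlt : h.2 < tdot h.1 (x + (0 : ℝ) • (y - x)) := by
        simpa using lt_of_le_of_ne (hx.1 h hh) (Ne.symm he)
      have hc : Continuous fun t : ℝ => tdot h.1 (x + t • (y - x)) :=
        (continuous_tdot h.1).comp (by fun_prop)
      exact (hc.continuousAt.eventually_const_lt hlt).mono fun t ht => ht.le
  have hneg : ∀ᶠ t : ℝ in nhds 0, x + (-t) • (y - x) ∈ polyhedron H := by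
    have : Filter.Tendsto (fun t : ℝ => -t) (nhds 0) (nhds 0) := by
      simpa using (continuous_neg (G := ℝ)).tendsto 0
    exact this.eventually hmem
  obtain ⟨t, ⟨h1, h2⟩, ht⟩ := (((hmem.and hneg).filter_mono nhdsWithin_le_nhds).and
    (self_mem_nhdsWithin : Set.Ioi (0 : ℝ) ∈ nhdsWithin 0 (Set.Ioi 0))).exists
  have hseg : x ∈ openSegment ℝ (x + t • (y - x)) (x + (-t) • (y - x)) :=
    ⟨1 / 2, 1 / 2, by norm_num, by norm_num, by norm_num, by module⟩
  have h3 := ((mem_extremePoints.1 hx).2 _ h1 _ h2 hseg).1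
  rw [add_eq_left, smul_eq_zero] at h3
  rcases h3 with h3 | h3
  · exact (ne_of_gt ht) h3
  · exact hne (sub_eq_zero.1 h3).symm

theorem isCompact_unitBall : IsCompact (unitBall q) := isCompact_closedBall 0 1

theorem convex_unitBall : Convex ℝ (unitBall q) := convex_closedBall 0 1

/-! ### Truncated recession cones of polyhedra -/

section Polyhedral

variable {H : Set (Outcome q × ℝ)}

theorem finite_extremePoints_recessionCone (hH : H.Finite) (hne : (polyhedron H).Nonempty) :
    (Set.extremePoints ℝ (recessionCone (polyhedron H) ∩ unitBall q)).Finite := by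
  rw [recessionCone_polyhedron hne, unitBall_eq_polyhedron, ← polyhedron_union]
  exact finite_extremePoints_polyhedron ((hH.image _).union (Set.finite_range _))

theorem finite_outerDirections (hH : H.Finite) (hne : (polyhedron H).Nonempty) :
    (outerDirections (polyhedron H)).Finite :=
  (finite_extremePoints_recessionCone hH hne).subset Set.sdiff_subset

theorem isClosed_recessionCone_polyhedron (hne : (polyhedron H).Nonempty) :
    IsClosed (recessionCone (polyhedron H)) := by
  rw [recessionCone_polyhedron hne]; exact isClosed_polyhedron _

/-- Krein–Milman; the closure can be dropped because there are only finitely many vertices. -/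
theorem convexHull_extremePoints_recessionCone (hH : H.Finite) (hne : (polyhedron H).Nonempty) :
    convexHull ℝ (Set.extremePoints ℝ (recessionCone (polyhedron H) ∩ unitBall q)) =
      recessionCone (polyhedron H) ∩ unitBall q := by
  have hconv : Convex ℝ (recessionCone (polyhedron H) ∩ unitBall q) :=
    (recessionPointedCone (polyhedron H)).convex.inter convex_unitBall
  have := closure_convexHull_extremePoints
    (isCompact_unitBall.inter_left (isClosed_recessionCone_polyhedron hne)) hconv
  rwa [((finite_extremePoints_recessionCone hH hne).isClosed_convexHull ℝ).closure_eq] at this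

theorem coneHull_outerDirections (hH : H.Finite) (hne : (polyhedron H).Nonempty) :
    (coneHull (outerDirections (polyhedron H)) : Set (Outcome q)) =
      recessionCone (polyhedron H) := by
  apply Set.Subset.antisymm
  · exact coneHull_le (K := recessionPointedCone (polyhedron H))
      fun d hd => (extremePoints_subset hd.1).1
  · intro d hd
    have hball : recessionCone (polyhedron H) ∩ unitBall q ⊆
        (coneHull (outerDirections (polyhedron H)) : Set (Outcome q)) := by
      rw [← convexHull_extremePoints_recessionCone hH hne]
      refine convexHull_min (fun e he => ?_) (coneHull _).convex
      by_cases h0 : e = 0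
      · exact h0 ▸ (coneHull _).zero_mem
      · exact subset_coneHull _ ⟨he, h0⟩
    -- Scaling by `1 + ‖d‖` instead of `‖d‖` brings `d` into the ball without a separate case for `d
    -- = 0`.
    have hpos : 0 < 1 + ‖d‖ := by positivity
    have hmem : (1 + ‖d‖)⁻¹ • d ∈ (coneHull (outerDirections (polyhedron H)) :
        Set (Outcome q)) := by
      refine hball ⟨(recessionPointedCone (polyhedron H)).smul_mem
        (inv_nonneg.2 hpos.le) hd, ?_⟩
      rw [unitBall, mem_closedBall_zero_iff, norm_smul, Real.norm_eq_abs,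
        abs_of_pos (inv_pos.2 hpos), inv_mul_le_iff₀ hpos]
      linarith
    have := (coneHull (outerDirections (polyhedron H))).smul_mem hpos.le hmem
    rwa [smul_smul, mul_inv_cancel₀ hpos.ne', one_smul] at this

/-- If every outer direction is close to a cone, then so is the truncated recession cone. -/
theorem recessionCone_inter_unitBall_subset_cthickening (hH : H.Finite)
    (hne : (polyhedron H).Nonempty) {K : PointedCone ℝ (Outcome q)} {δ : ℝ}
    (h : ∀ d ∈ outerDirections (polyhedron H), ∃ r ∈ (K : Set (Outcome q)) ∩ unitBall q,
      ‖d - r‖ ≤ δ) :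
    recessionCone (polyhedron H) ∩ unitBall q ⊆
      Metric.cthickening δ ((K : Set (Outcome q)) ∩ unitBall q) := by
  rw [← convexHull_extremePoints_recessionCone hH hne]
  refine convexHull_min (fun e he => ?_) ((K.convex.inter convex_unitBall).cthickening δ)
  by_cases h0 : e = 0
  · refine Metric.self_subset_cthickening _ ⟨h0 ▸ K.zero_mem, ?_⟩
    simp [h0, unitBall]
  · obtain ⟨r, hr, hd⟩ := h e ⟨he, h0⟩
    exact Metric.mem_cthickening_of_dist_le _ r _ _ hr (by rwa [dist_eq_norm])

end Polyhedral

/-! ### The upper image -/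

namespace VOP

variable {P : VOP n q}

/-- The defect in the `C`-convexity inequality lies in `C` and is absorbed by `K`. Needed for `K =
C` and for `K = int C`. -/
theorem convex_image_add_cone (hX : Convex ℝ P.X) (hΓ : P.CConvex) {K : Set (Outcome q)}
    (hK : Convex ℝ K) (hadd : ∀ a ∈ K, ∀ b ∈ P.C, a + b ∈ K) :
    Convex ℝ (P.Γ '' P.X + K) := by
  rintro _ ⟨_, ⟨x, hx, rfl⟩, e, he, rfl⟩ _ ⟨_, ⟨y, hy, rfl⟩, f, hf, rfl⟩ a b ha hb hab
  obtain rfl : b = 1 - a := by linarith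
  refine ⟨_, ⟨a • x + (1 - a) • y, hX hx hy ha hb hab, rfl⟩, _,
    hadd _ (hK he hf ha hb hab) _ (hΓ x hx y hy a ha (by linarith)), ?_⟩
  simp only
  module

theorem convex_upperImage (hP : P.IsCVOP) : Convex ℝ P.upperImage :=
  (convex_image_add_cone hP.convex_X hP.cconvex_Γ P.C.convex
    fun _ ha _ hb => P.C.add_mem ha hb).closure

theorem image_add_mem_upperImage {x : Decision n} (hx : x ∈ P.X) {e : Outcome q} (he : e ∈ P.C) :
    P.Γ x + e ∈ P.upperImage :=
  subset_closure ⟨_, ⟨x, hx, rfl⟩, e, he, rfl⟩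

theorem upperImage_nonempty (hP : P.Feasible) : P.upperImage.Nonempty :=
  let ⟨_, hx⟩ := hP
  ⟨_, image_add_mem_upperImage hx P.C.zero_mem⟩

theorem cone_subset_recessionCone : (P.C : Set (Outcome q)) ⊆ recessionCone P.upperImage := by
  intro d hd y hy α hα
  refine map_mem_closure (f := fun y => y + α • d) (by fun_prop) hy ?_
  rintro _ ⟨a, ha, e, he, rfl⟩
  refine ⟨a, ha, _, P.C.add_mem he (P.C.smul_mem hα hd), ?_⟩
  simp only [add_assoc]

theorem le_tdot_of_mem_upperImage {w : Outcome q} (hw : w ∈ dualCone (P.C : Set (Outcome q)))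
    {γ : ℝ} (h : ∀ x ∈ P.X, γ ≤ tdot w (P.Γ x)) {y : Outcome q} (hy : y ∈ P.upperImage) :
    γ ≤ tdot w y := by
  refine closure_minimal ?_ (isClosed_le continuous_const (continuous_tdot w)) hy
  rintro _ ⟨_, ⟨x, hx, rfl⟩, e, he, rfl⟩
  change γ ≤ tdot w (P.Γ x + e)
  rw [tdot_add]
  linarith [h x hx, hw e he]

theorem P2Feasible.exists_mem {v d : Outcome q} {x : Decision n} {z : ℝ}
    (h : P.P2Feasible v d x z) : ∃ e ∈ P.C, v + z • d = P.Γ x + e :=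
  ⟨_, h.2, by module⟩

theorem mem_recessionCone_of_P2Unbounded (hP : P.IsCVOP) {v d : Outcome q}
    (h : P.P2Unbounded v d) : d ∈ recessionCone P.upperImage := by
  refine mem_recessionCone_of_unbounded (v := v) (convex_upperImage hP) isClosed_closure
    fun hb => h (hb.mono ?_)
  rintro z ⟨x, hx⟩
  obtain ⟨e, he, heq⟩ := hx.exists_mem
  change v + z • d ∈ P.upperImage
  exact heq ▸ image_add_mem_upperImage hx.1 he

/-! ### Strong duality for the Pascoletti–Serafini scalarization -/

theorem D2Objective_le_coe {v w : Outcome q} {z : ℝ} :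
    P.D2Objective v w ≤ z ↔ ∀ x ∈ P.X, -tdot w (P.Γ x) + tdot w v ≤ z := by
  rw [D2Objective, ← EReal.le_sub_iff_add_le (Or.inl (EReal.coe_ne_bot _))
    (Or.inl (EReal.coe_ne_top _)), iSup₂_le_iff]
  refine forall₂_congr fun x _ => ?_
  rw [← EReal.coe_sub, EReal.coe_le_coe_iff, le_sub_iff_add_le]

/-- Under the Slater condition `v ∈ Γ(x₀) + int C`, the dual problem attains a value at most that
of the primal problem. -/
theorem exists_D2Feasible_le (hP : P.IsCVOP) {v d : Outcome q} {x₀ x : Decision n} {z : ℝ}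
    (hx₀ : x₀ ∈ P.X) (hv : v - P.Γ x₀ ∈ interior (P.C : Set (Outcome q)))
    (hopt : P.P2Optimal v d x z) :
    ∃ w, P.D2Feasible d w ∧ P.D2Objective v w ≤ z := by
  set U : Set (Outcome q) := P.Γ '' P.X + interior (P.C : Set (Outcome q)) with hU
  have hUconv : Convex ℝ U := convex_image_add_cone hP.convex_X hP.cconvex_Γ
    P.C.convex.interior fun a ha b hb => add_mem_interior ha hb
  have hUopen : IsOpen U := isOpen_interior.add_left
  -- Membership in the open set would leave room to increase `z`, against optimality.
  have hnot : v + z • d ∉ U := by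
    rintro ⟨_, ⟨x', hx', rfl⟩, e, he, heq⟩
    have hc : Continuous fun t : ℝ => e + t • d := by fun_prop
    have hnear : ∀ᶠ t : ℝ in nhds 0, e + t • d ∈ P.C :=
      hc.continuousAt (by simpa using mem_interior_iff_mem_nhds.1 he)
    obtain ⟨t, ht, htpos⟩ := ((hnear.filter_mono nhdsWithin_le_nhds).and
      (self_mem_nhdsWithin : Set.Ioi (0 : ℝ) ∈ nhdsWithin 0 (Set.Ioi 0))).exists
    have hfeas : P.P2Feasible v d x' (z + t) := by
      refine ⟨hx', ?_⟩
      change 0 - (P.Γ x' - v - (z + t) • d) ∈ P.C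
      have : 0 - (P.Γ x' - v - (z + t) • d) = (v + z • d) - P.Γ x' + t • d := by module
      rw [this, ← heq]
      simpa using ht
    have h1 := hopt.2 _ _ hfeas
    have h2 : 0 < t := htpos
    linarith
  obtain ⟨f, hf⟩ := geometric_hahn_banach_open_point hUconv hUopen hnot
  obtain ⟨w, hw⟩ := exists_tdot_eq (-f).toLinearMap
  have hfw : ∀ y, f y = -tdot w y := fun y => by
    rw [← hw y]; simp
  have hlt : ∀ x' ∈ P.X, ∀ e ∈ interior (P.C : Set (Outcome q)),
      tdot w (v + z • d) < tdot w (P.Γ x') + tdot w e := fun x' hx' e he => by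
    have := hf _ ⟨_, ⟨x', hx', rfl⟩, e, he, rfl⟩
    simp only [hfw] at this
    rw [tdot_add w (P.Γ x')] at this
    linarith
  -- The separation extends from `int C` to `C`, at the price of strictness, since a solid convex
  -- cone lies in the closure of its interior.
  have hlim : ∀ x' ∈ P.X, ∀ e ∈ P.C,
      tdot w (v + z • d) ≤ tdot w (P.Γ x') + tdot w e := fun x' hx' e he => by
    have hsub : interior (P.C : Set (Outcome q)) ⊆
        {e | tdot w (v + z • d) ≤ tdot w (P.Γ x') + tdot w e} :=
      fun e he => (hlt x' hx' e he).le
    have hcl : IsClosed {e | tdot w (v + z • d) ≤ tdot w (P.Γ x') + tdot w e} :=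
      isClosed_le continuous_const (continuous_const.add (continuous_tdot w))
    refine closure_minimal hsub hcl ?_
    rw [P.C.convex.closure_interior_eq_closure_of_nonempty_interior hP.solid_C]
    exact subset_closure he
  have hdual : w ∈ dualCone (P.C : Set (Outcome q)) := fun e he => by
    by_contra hneg
    push Not at hneg
    -- With this `t`, the bound `hlim` at `t • e` would read `a ≤ a - 1`.
    set t := (tdot w (P.Γ x₀) - tdot w (v + z • d) + 1) / (-tdot w e) with ht
    have h0 := hlim x₀ hx₀ 0 P.C.zero_mem
    rw [tdot_zero] at h0
    have ht0 : 0 ≤ t := div_nonneg (by linarith) (by linarith)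
    have h1 := hlim x₀ hx₀ _ (P.C.smul_mem ht0 he)
    rw [tdot_smul, ht, div_mul_eq_mul_div, div_neg, mul_div_assoc, div_self hneg.ne] at h1
    linarith
  have hz : 0 ≤ z := hopt.2 x₀ 0 ⟨hx₀, by
    change 0 - (P.Γ x₀ - v - (0 : ℝ) • d) ∈ P.C
    have h : 0 - (P.Γ x₀ - v - (0 : ℝ) • d) = v - P.Γ x₀ := by module
    exact h ▸ interior_subset hv⟩
  -- The Slater point enters here: the strict inequality becomes `z * tdot w d < 0`, and `z ≥ 0`
  -- forces `tdot w d < 0`, so `w` can be normalized to be dual feasible.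
  have hs := hlt x₀ hx₀ _ hv
  rw [tdot_sub, tdot_add, tdot_smul] at hs
  have hwd : tdot w d < 0 := by
    by_contra hge
    have := mul_nonneg hz (not_lt.1 hge)
    linarith
  set k : ℝ := (-tdot w d)⁻¹ with hk
  have hk0 : 0 < k := inv_pos.2 (by linarith)
  have hkd : k * tdot w d = -1 := by
    rw [hk, inv_neg, neg_mul, inv_mul_cancel₀ hwd.ne]
  have hsm : ∀ y, tdot (k • w) y = k * tdot w y := fun y => by
    rw [tdot_comm, tdot_smul, tdot_comm]
  refine ⟨k • w, ⟨fun e he => ?_, by rw [hsm, hkd]⟩, D2Objective_le_coe.2 fun x' hx' => ?_⟩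
  · rw [hsm]; exact mul_nonneg hk0.le (hdual e he)
  · have h1 := hlim x' hx' 0 P.C.zero_mem
    rw [tdot_zero, tdot_add, tdot_smul] at h1
    have h2 := mul_le_mul_of_nonneg_left h1 hk0.le
    have h3 : k * (z * tdot w d) = -z := by rw [mul_left_comm, hkd]; ring
    rw [hsm, hsm]
    linarith

/-- A primal optimal solution minimizes the functional given by any dual optimal solution. -/
theorem tdot_le_of_optimal (hP : P.IsCVOP) {v d w : Outcome q} {x₀ x : Decision n} {z : ℝ}
    (hx₀ : x₀ ∈ P.X) (hv : v - P.Γ x₀ ∈ interior (P.C : Set (Outcome q)))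
    (hopt : P.P2Optimal v d x z) (hw : P.D2Optimal v d w) {x' : Decision n} (hx' : x' ∈ P.X) :
    tdot w (P.Γ x) ≤ tdot w (P.Γ x') := by
  obtain ⟨w', hw', hle⟩ := exists_D2Feasible_le hP hx₀ hv hopt
  have h1 := D2Objective_le_coe.1 ((hw.2 w' hw').trans hle) x' hx'
  -- Applying `w` to `v + z d = Γ(x) + e` gives `wᵀΓ(x) ≤ wᵀv - z`, while `h1` bounds `wᵀΓ(x')`
  -- below by the same number.
  obtain ⟨e, he, heq⟩ := hopt.1.exists_mem
  have h2 := congrArg (tdot w) heq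
  rw [tdot_add, tdot_add, tdot_smul, hw.1.2] at h2
  linarith [hw.1.1 e he]

/-! ### Outer approximations of the upper image -/

/-- `A` is a polyhedron that contains the upper image and is cut out by finitely many
inequalities whose normals are positive at `c`. -/
def IsOuterPolyhedron (P : VOP n q) (c : Outcome q) (A : Set (Outcome q)) : Prop :=
  ∃ H : Set (Outcome q × ℝ), H.Finite ∧ A = polyhedron H ∧ P.upperImage ⊆ A ∧
    ∀ h ∈ H, 0 < tdot h.1 c

variable {c : Outcome q} {A : Set (Outcome q)}

theorem isOuterPolyhedron_univ : P.IsOuterPolyhedron c Set.univ :=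
  ⟨∅, Set.finite_empty, by simp [polyhedron], Set.subset_univ _, by simp⟩

theorem IsOuterPolyhedron.inter_halfspace (hA : P.IsOuterPolyhedron c A) {w : Outcome q}
    {x : Decision n} (hw : w ∈ dualCone (P.C : Set (Outcome q))) (hwc : 0 < tdot w c)
    (h : ∀ x' ∈ P.X, tdot w (P.Γ x) ≤ tdot w (P.Γ x')) :
    P.IsOuterPolyhedron c (A ∩ halfspace w (P.Γ x)) := by
  obtain ⟨H, hfin, rfl, hsub, hpos⟩ := hA
  refine ⟨H ∪ {(w, tdot w (P.Γ x))}, hfin.union (Set.finite_singleton _), ?_, ?_, ?_⟩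
  · rw [polyhedron_union, halfspace_eq_polyhedron]
  · refine Set.subset_inter hsub fun y hy => ?_
    change 0 ≤ tdot w (y - P.Γ x)
    rw [tdot_sub, sub_nonneg]
    exact le_tdot_of_mem_upperImage hw h hy
  · rintro _ (hh | rfl)
    · exact hpos _ hh
    · exact hwc

theorem IsOuterPolyhedron.nonempty (hA : P.IsOuterPolyhedron c A) (hP : P.Feasible) :
    A.Nonempty := by
  obtain ⟨H, -, -, hsub, -⟩ := hA
  exact (upperImage_nonempty hP).mono hsub

theorem IsOuterPolyhedron.recessionCone_subset (hA : P.IsOuterPolyhedron c A)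
    (hP : P.Feasible) : recessionCone P.upperImage ⊆ recessionCone A := by
  have hne := hA.nonempty hP
  obtain ⟨H, -, rfl, hsub, -⟩ := hA
  intro d hd
  rw [recessionCone_polyhedron hne]
  rintro _ ⟨h, hh, rfl⟩
  exact tdot_nonneg_of_mem_recessionCone (upperImage_nonempty hP)
    (fun y hy => hsub hy h hh) hd

/-- The problem is bounded with respect to the recession cone of an outer polyhedron. -/
theorem IsOuterPolyhedron.bounded_withCone (hA : P.IsOuterPolyhedron c A) (hP : P.Feasible)
    {K : PointedCone ℝ (Outcome q)} (hK : (K : Set (Outcome q)) = recessionCone A) :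
    (P.withCone K).Bounded := by
  have hne := hA.nonempty hP
  obtain ⟨H, hfin, rfl, hsub, hpos⟩ := hA
  refine ⟨le_rfl, ?_, ?_⟩
  · change IsClosed (K : Set (Outcome q))
    rw [hK]; exact isClosed_recessionCone_polyhedron hne
  -- Because the normals are positive at `c`, one shift `t • c` makes all finitely many inequalities
  -- homogeneous at once.
  obtain ⟨t, ht⟩ := (hfin.image fun h : Outcome q × ℝ => -h.2 / tdot h.1 c).bddAbove
  refine ⟨-(t • c), ?_⟩
  have himage : (P.withCone K).upperImage ⊆ polyhedron H := by
    refine closure_minimal ?_ (isClosed_polyhedron H)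
    rintro _ ⟨_, ⟨x, hx, rfl⟩, e, he, rfl⟩
    have he' : e ∈ recessionCone (polyhedron H) := hK ▸ he
    have hx' : P.Γ x ∈ polyhedron H := hsub (by
      simpa using image_add_mem_upperImage (P := P) hx P.C.zero_mem)
    have := he' _ hx' 1 zero_le_one
    rwa [one_smul] at this
  intro y hy
  refine ⟨_, rfl, y + t • c, ?_, by simp⟩
  change y + t • c ∈ (K : Set (Outcome q))
  rw [hK, recessionCone_polyhedron hne]
  rintro _ ⟨h, hh, rfl⟩
  have h1 := himage hy h hh
  have h2 : -h.2 / tdot h.1 c ≤ t := ht ⟨h, hh, rfl⟩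
  rw [div_le_iff₀ (hpos h hh)] at h2
  change 0 ≤ tdot h.1 (y + t • c)
  rw [tdot_add, tdot_smul]
  linarith

/-- By the sandwich `cone YIn ⊆ P_∞ ⊆ A_∞ = cone YOut`, the single estimate between the two outer
members controls both Hausdorff distances. -/
theorem IsOuterPolyhedron.isFiniteApprox (hA : P.IsOuterPolyhedron c A) (hP : P.Feasible)
    {δ : ℝ} {YOut YIn : Set (Outcome q)} (hOut : YOut.Finite) (hIn : YIn.Finite)
    (hcone : (coneHull YOut : Set (Outcome q)) = recessionCone A)
    (hYIn : YIn ⊆ recessionCone P.upperImage)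
    (hclose : recessionCone A ∩ unitBall q ⊆
      Metric.cthickening δ ((coneHull YIn : Set (Outcome q)) ∩ unitBall q)) :
    P.IsFiniteOuterApprox δ YOut ∧ P.IsFiniteInnerApprox δ YIn := by
  have hsub := hA.recessionCone_subset hP
  have hin : (coneHull YIn : Set (Outcome q)) ⊆ recessionCone P.upperImage :=
    coneHull_le (K := recessionPointedCone P.upperImage) hYIn
  refine ⟨⟨hOut, hcone ▸ hsub, ?_⟩, ⟨hIn, hin, ?_⟩⟩
  · refine Metric.hausdorffEDist_le_of_infEDist (fun d hd => ?_) fun d hd => ?_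
    · rw [hcone, Metric.infEDist_zero_of_mem (Set.inter_subset_inter_left _ hsub hd)]
      exact zero_le
    · rw [hcone] at hd
      exact (Metric.infEDist_anti (Set.inter_subset_inter_left _ hin)).trans (hclose hd)
  · refine Metric.hausdorffEDist_le_of_infEDist (fun d hd => ?_) fun d hd => ?_
    · exact hclose (Set.inter_subset_inter_left _ hsub hd)
    · rw [Metric.infEDist_zero_of_mem (Set.inter_subset_inter_left _ hin hd)]
      exact zero_le

end VOP

/-! ### The invariant of the algorithm -/

/-- The Slater condition for the reference point. -/
def IsReferencePoint (P : VOP n q) (v : Outcome q) : Prop :=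
  ∃ x₀ ∈ P.X, v - P.Γ x₀ ∈ interior (P.C : Set (Outcome q))

/-- Each `z` of a set of weights is bounded below on `A`. -/
def BoundsWeights (Z A : Set (Outcome q)) : Prop := ∀ z ∈ Z, ∃ γ, ∀ y ∈ A, γ ≤ tdot z y

/-- The part of the invariant that depends on the program counter. -/
def PhaseInvariant (P : VOP n q) (R' : Finset (Outcome q)) (δ : ℝ) (s : State n q) :
    Phase q → Prop
  | .feasibility => True
  | .boundedness todo => IsReferencePoint P s.v ∧ todo ⊆ R' ∧
      (s.b = true → BoundsWeights ((R' : Set (Outcome q)) \ todo) s.P0)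
  | .decide => IsReferencePoint P s.v ∧ (s.b = true → BoundsWeights (R' : Set (Outcome q)) s.P0)
  | .lineality todo => IsReferencePoint P s.v ∧ ∀ d ∈ todo, ‖d‖ = 1
  | .outer => IsReferencePoint P s.v
  | .iteration => IsReferencePoint P s.v ∧ s.YOut = outerDirections s.P0
  | .stopped => s.YOut.Finite ∧ (coneHull s.YOut : Set (Outcome q)) = recessionCone s.P0 ∧
      recessionCone s.P0 ∩ unitBall q ⊆
        Metric.cthickening δ ((coneHull s.YIn : Set (Outcome q)) ∩ unitBall q)

/-- The invariant of the algorithm. -/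
structure Invariant (P : VOP n q) (c : Outcome q) (R R' : Finset (Outcome q)) (δ : ℝ)
    (s : State n q) : Prop where
  finite_YIn : s.YIn.Finite
  generators_subset : (R : Set (Outcome q)) ⊆ s.YIn
  norm_YIn : ∀ r ∈ s.YIn, ‖r‖ = 1
  YIn_subset : s.YIn ⊆ recessionCone P.upperImage
  outer : P.IsOuterPolyhedron c s.P0
  close : ∀ d ∈ s.Chat, ∃ r ∈ s.YIn, ‖d - r‖ ≤ δ
  phase : PhaseInvariant P R' δ s s.phase

/-! ### Preservation of the invariant along a run -/

section Run

variable {P : VOP n q} {c : Outcome q} {R R' : Finset (Outcome q)} {δ : ℝ} {s t : State n q}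

theorem invariant_initState (hR : IsGenerators P.C R) :
    Invariant P c R R' δ (initState n R) where
  finite_YIn := R.finite_toSet
  generators_subset := subset_rfl
  norm_YIn := hR.2
  YIn_subset := fun _ hd => VOP.cone_subset_recessionCone (hR.1 ▸ subset_coneHull _ hd)
  outer := VOP.isOuterPolyhedron_univ
  close := fun _ hd => hd.elim
  phase := trivial

theorem Invariant.isOuterPolyhedron_inter (hP : P.IsCVOP)
    (hc : c ∈ interior (P.C : Set (Outcome q))) (hs : Invariant P c R R' δ s)
    (hv : IsReferencePoint P s.v) {d w : Outcome q} {x : Decision n} {z : ℝ}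
    (hx : P.P2Optimal s.v d x z) (hw : P.D2Optimal s.v d w) :
    P.IsOuterPolyhedron c (s.P0 ∩ halfspace w (P.Γ x)) := by
  obtain ⟨x₀, hx₀, hv⟩ := hv
  refine hs.outer.inter_halfspace hw.1.1 ?_ fun x' hx' =>
    VOP.tdot_le_of_optimal hP hx₀ hv hx hw hx'
  exact tdot_pos_of_mem_interior hc hw.1.1 (d := d) (by rw [hw.1.2]; norm_num)

theorem Invariant.phase_of_eq (hs : Invariant P c R R' δ s) {p : Phase q} (h : s.phase = p) :
    PhaseInvariant P R' δ s p :=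
  h ▸ hs.phase

/-- If all weights generating `C⁺` are bounded below on `P₀`, then `(P₀)_∞ = C`. -/
theorem Invariant.recessionCone_eq (hP : P.IsCVOP) (hfeas : P.Feasible)
    (hR' : IsDualGenerators P.C c R') (hs : Invariant P c R R' δ s)
    (hb : BoundsWeights (R' : Set (Outcome q)) s.P0) :
    recessionCone s.P0 = (P.C : Set (Outcome q)) := by
  apply Set.Subset.antisymm
  · intro d hd
    -- By the bipolar theorem it suffices to test against `C⁺`, hence against its generators.
    refine mem_of_forall_dualCone hP.closed_C fun w hw => ?_
    rw [← hR'.1] at hw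
    refine tdot_nonneg_of_mem_coneHull (fun z hz => ?_) hw
    obtain ⟨γ, hγ⟩ := hb z hz
    exact tdot_nonneg_of_mem_recessionCone (hs.outer.nonempty hfeas) hγ hd
  · exact VOP.cone_subset_recessionCone.trans (hs.outer.recessionCone_subset hfeas)

theorem Invariant.mem_unitBall (hs : Invariant P c R R' δ s) {r : Outcome q} (hr : r ∈ s.YIn) :
    r ∈ (coneHull s.YIn : Set (Outcome q)) ∩ unitBall q :=
  ⟨subset_coneHull _ hr, by rw [unitBall, mem_closedBall_zero_iff, hs.norm_YIn r hr]⟩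

theorem BoundsWeights.mono {Z A B : Set (Outcome q)} (h : BoundsWeights Z A) (hBA : B ⊆ A) :
    BoundsWeights Z B := fun z hz =>
  let ⟨γ, hγ⟩ := h z hz
  ⟨γ, fun y hy => hγ y (hBA hy)⟩

theorem Invariant.step (hP : P.IsCVOP) (hfeas : P.Feasible)
    (hc : c ∈ interior (P.C : Set (Outcome q))) (hR : IsGenerators P.C R)
    (hR' : IsDualGenerators P.C c R') (hδ : 0 ≤ δ) (hs : Invariant P c R R' δ s)
    (hst : Step P R R' δ s t) : Invariant P c R R' δ t := by
  cases hst with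
  | infeasible _ h => exact absurd hfeas h
  | feasible x₀ hph hx₀ =>
    refine { hs with phase := ⟨⟨x₀, hx₀, ?_⟩, subset_rfl, fun _ z hz => absurd hz.1 hz.2⟩ }
    simpa using sum_generators_mem_interior hR.1 hc
  | p1Unbounded todo z hph hz hunb =>
    have hph := hs.phase_of_eq hph
    exact { hs with
      phase := ⟨hph.1, Set.sdiff_subset.trans hph.2.1, fun h => absurd h Bool.false_ne_true⟩ }
  | p1Optimal todo z x hph hz hx =>
    have hph := hs.phase_of_eq hph
    have hzR : z ∈ R' := hph.2.1 hz
    have hzd : z ∈ dualCone (P.C : Set (Outcome q)) := hR'.1 ▸ subset_coneHull _ hzR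
    refine { hs with
      outer := hs.outer.inter_halfspace hzd (by rw [tdot_comm, hR'.2 z hzR]; norm_num) hx.2
      phase := ⟨hph.1, Set.sdiff_subset.trans hph.2.1, fun hb z' hz' => ?_⟩ }
    by_cases hzz : z' = z
    · refine ⟨tdot z (P.Γ x), fun y hy => ?_⟩
      have : 0 ≤ tdot z (y - P.Γ x) := hy.2
      rw [tdot_sub] at this
      rw [hzz]; linarith
    · exact (hph.2.2 hb).mono Set.inter_subset_left z' ⟨hz'.1, fun h => hz'.2 ⟨h, hzz⟩⟩
  | boundednessDone hph =>
    have hph := hs.phase_of_eq hph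
    exact { hs with phase := ⟨hph.1, fun hb => by simpa using hph.2.2 hb⟩ }
  | stopBounded hph hb =>
    have hrec := hs.recessionCone_eq hP hfeas hR' ((hs.phase_of_eq hph).2 hb)
    refine { hs with phase := ⟨R.finite_toSet, ?_, ?_⟩ }
    · change (coneHull (R : Set (Outcome q)) : Set (Outcome q)) = recessionCone s.P0
      rw [hR.1, hrec]
    · refine Set.Subset.trans ?_ (Metric.self_subset_cthickening _)
      -- Here `(P0)_∞ = C = cone R ⊆ cone YIn`, so the distance to be bounded is zero.
      change recessionCone s.P0 ∩ _ ⊆ _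
      rw [hrec, ← hR.1]
      exact Set.inter_subset_inter_left _ (Submodule.span_mono hs.generators_subset)
  | continueUnbounded hph hb =>
    refine { hs with phase := ⟨(hs.phase_of_eq hph).1, fun d hd => ?_⟩ }
    rw [← norm_neg]
    exact hR.2 _ hd
  | linealityUnbounded todo d hph hd hunb =>
    have hph := hs.phase_of_eq hph
    refine { hs with
      finite_YIn := hs.finite_YIn.union (Set.finite_singleton d)
      generators_subset := hs.generators_subset.trans Set.subset_union_left
      norm_YIn := ?_
      YIn_subset := Set.union_subset hs.YIn_subset (Set.singleton_subset_iff.2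
        (VOP.mem_recessionCone_of_P2Unbounded hP hunb))
      close := fun e he => let ⟨r, hr, h⟩ := hs.close e he; ⟨r, Or.inl hr, h⟩
      phase := ⟨hph.1, fun e he => hph.2 e he.1⟩ }
    rintro r (hr | rfl)
    · exact hs.norm_YIn r hr
    · exact hph.2 _ hd
  | linealityOptimal todo d x z w hph hd hx hw =>
    have hph := hs.phase_of_eq hph
    exact { hs with
      outer := hs.isOuterPolyhedron_inter hP hc hph.1 hx hw
      phase := ⟨hph.1, fun e he => hph.2 e he.1⟩ }
  | linealityDone hph => exact { hs with phase := (hs.phase_of_eq hph).1 }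
  | computeOuter hph => exact { hs with phase := ⟨hs.phase_of_eq hph, rfl⟩ }
  | close d r hph hd hr hmin hle =>
    refine { hs with
      close := ?_
      phase := ?_ }
    · rintro e (he | rfl)
      · exact hs.close e he
      · exact ⟨r, hr, hle⟩
    · change PhaseInvariant P R' δ _ s.phase
      have := hs.phase_of_eq hph
      rw [hph]; exact this
  | farUnbounded d r lam hph hd hr hmin hlt h0 h1 hne hunb =>
    refine { hs with
      finite_YIn := hs.finite_YIn.union (Set.finite_singleton _)
      generators_subset := hs.generators_subset.trans Set.subset_union_left
      norm_YIn := ?_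
      YIn_subset := Set.union_subset hs.YIn_subset (Set.singleton_subset_iff.2
        ((recessionPointedCone P.upperImage).smul_mem (inv_nonneg.2 (norm_nonneg _))
        (VOP.mem_recessionCone_of_P2Unbounded hP hunb)))
      close := fun e he => let ⟨r, hr, h⟩ := hs.close e he; ⟨r, Or.inl hr, h⟩
      phase := ?_ }
    · rintro e (he | rfl)
      · exact hs.norm_YIn e he
      · rw [norm_smul, norm_inv, norm_norm, inv_mul_cancel₀ (norm_ne_zero_iff.2 hne)]
    · change PhaseInvariant P R' δ _ s.phase
      have := hs.phase_of_eq hph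
      rw [hph]; exact this
  | farOptimal d r lam x z w hph hd hr hmin hlt h0 h1 hne hx hw =>
    have hph' := hs.phase_of_eq hph
    refine { hs with
      outer := hs.isOuterPolyhedron_inter hP hc hph'.1 hx hw
      phase := ?_ }
    change PhaseInvariant P R' δ _ s.phase
    rw [hph]; exact ⟨hph'.1, rfl⟩
  | iterationDone hph hdone =>
    have hout := (hs.phase_of_eq hph).2
    have hne := hs.outer.nonempty hfeas
    obtain ⟨H, hH, hP0, -, -⟩ := hs.outer
    refine { hs with phase := ?_ }
    change s.YOut.Finite ∧ (coneHull s.YOut : Set (Outcome q)) = recessionCone s.P0 ∧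
      recessionCone s.P0 ∩ unitBall q ⊆
        Metric.cthickening δ ((coneHull s.YIn : Set (Outcome q)) ∩ unitBall q)
    rw [hout, hP0] at hdone ⊢
    rw [hP0] at hne
    refine ⟨finite_outerDirections hH hne, coneHull_outerDirections hH hne,
      recessionCone_inter_unitBall_subset_cthickening hH hne fun d hd => ?_⟩
    -- At loop exit an outer direction is itself an inner direction or was put into `Ĉ` with a
    -- `δ`-close inner direction as witness.
    rcases Set.sdiff_eq_empty.1 hdone hd with h | h
    · exact ⟨d, hs.mem_unitBall h, by simpa using hδ⟩
    · obtain ⟨r, hr, hle⟩ := hs.close d h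
      exact ⟨r, hs.mem_unitBall hr, hle⟩

theorem invariant_of_reachable (hP : P.IsCVOP) (hfeas : P.Feasible)
    (hc : c ∈ interior (P.C : Set (Outcome q))) (hR : IsGenerators P.C R)
    (hR' : IsDualGenerators P.C c R') (hδ : 0 ≤ δ)
    (h : Relation.ReflTransGen (Step P R R' δ) (initState n R) s) : Invariant P c R R' δ s := by
  induction h with
  | refl => exact invariant_initState hR
  | tail _ hst ih => exact ih.step hP hfeas hc hR hR' hδ hst

end Run

end CVOPAlg

end

theorem mainTheorem1 {n q : ℕ} (P : CVOPAlg.VOP n q) (hP : P.IsPolyhedralCVOP)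
    (hfeas : P.Feasible)
    (c : CVOPAlg.Outcome q) (hc : c ∈ interior (P.C : Set (CVOPAlg.Outcome q)))
    (hc_norm : ‖c‖ = 1)
    (R R' : Finset (CVOPAlg.Outcome q)) (hR : CVOPAlg.IsGenerators P.C R)
    (hR' : CVOPAlg.IsDualGenerators P.C c R')
    (δ : ℝ) (hδ : 0 < δ)
    (s : CVOPAlg.State n q) (hs : CVOPAlg.TerminatesWith P R R' δ s) :
    P.IsFiniteOuterApprox δ s.YOut ∧ P.IsFiniteInnerApprox δ s.YIn ∧
      (P.withCone (CVOPAlg.coneHull s.YOut)).Bounded := by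
  have hinv := CVOPAlg.invariant_of_reachable hP.toIsCVOP hfeas hc hR hR' hδ.le hs.1
  obtain ⟨hfin, hcone, hclose⟩ := hinv.phase_of_eq hs.2
  have happrox := hinv.outer.isFiniteApprox hfeas hfin hinv.finite_YIn hcone hinv.YIn_subset hclose
  exact ⟨happrox.1, happrox.2, hinv.outer.bounded_withCone hfeas hcone⟩
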